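/- **Setting.** Let $n\in\mathbb N$. A request sequence is a finite list $E=((N_t,q_t))_{t\in[m]}$ with $m\in\mathbb N$, nonempty $N_t\subseteq[n]$ and $q_t>0$; its total quantity is $\sum_t q_t$. Let $\Delta(N_t,q_t)$ be the set of $x\in\mathbb R_{\ge0}^n$ with $x(i)=0$ for $i\notin N_t$ and $\sum_i x(i)=q_t$, and let $\Delta(E)$ be the Minkowski sum of the sets $\Delta(N_t,q_t)$, $t\in[m]$. A deterministic policy $\mathcal A$ chooses, on the arrival of node $t$, an allocation $x_t\in\Delta(N_t,q_t)$ as a function of $(N_1,q_1),\dots,(N_t,q_t)$ only; put $\mathcal A(E)=\sum_t x_t$. The water-filling policy $\mathrm{WF}$ chooses the unique $x_t\in\Delta(N_t,q_t)$ that maximizes $\min_{i\in N_t}\bigl(x_t(i)+\ell_{t-1}(i)\bigr)$, where $\ell_{t-1}=\sum_{s<t}x_s$. For $x,y\in\mathbb R_{\ge0}^n$ write $x\preceq y$ if $\sum_i x(i)=\sum_i y(i)$ and, for every $j\in[n]$, the sum of the $j$ largest entries of $x$ is at most the sum of the $j$ largest entries of $y$. A function $f:\mathbb R_{\ge0}^n\to\mathbb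 R_{\ge0}$ is Schur-concave if $x\preceq y$ implies $f(x)\ge f(y)$. For $\alpha>0$ and a class $\mathcal S$ of request sequences, the $\alpha$-regret of a deterministic policy $\mathcal A$ over $\mathcal S$ is $$\mathrm{Reg}^{\mathcal S}_{\alpha,f}(\mathcal A)=\sup_{E\in\mathcal S}\Bigl(\alpha\cdot\sup_{\ell\in\Delta(E)}f(\ell)-f(\mathcal A(E))\Bigr)\in[-\infty,+\infty].$$ Let $\mathcal E_n$ be the class of all request sequences with $n$ offline nodes (any $m$, any total quantity $q\ge0$; $q=0$ means that $E$ is the empty sequence), and let $\mathcal E_n^{+}$ be the class of those with total quantity $q>0$. Let $H\in\mathbb R^{n\times n}$ be the harmonic matrix, $H(i,j)=\frac{1}{n-j+1}$ if $i\ge j$ and $H(i,j)=0$ otherwise. **Statement.** For all $n\in\mathbb N$, $\alpha>0$ and Schur-concave $f:\mathbb R_{\ge0}^n\to\mathbb R_{\ge0}$, the minimax optimal $\alpha$-regret satisfies $$\mathrm{Reg}^{\mathcal E_n}_{\alpha,f}(\mathrm{WF})=\sup_{\ell\in\mathbb R^n:\ 0\le\ell(1)\le\cdots\le\ell(n)}\bigl(\alpha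 f(\ell)-f(H\ell)\bigr),$$ $$\mathrm{Reg}^{\mathcal E_n^{+}}_{\alpha,f}(\mathrm{WF})=\sup_{\ell\in\mathbb R^n:\ 0\le\ell(1)\le\cdots\le\ell(n),\ \ell\ne0}\bigl(\alpha f(\ell)-f(H\ell)\bigr),$$ where suprema are taken in $[-\infty,+\infty]$, and these regrets are minimax optimal among deterministic policies: for every deterministic policy $\mathcal A$, $\mathrm{Reg}^{\mathcal E_n}_{\alpha,f}(\mathrm{WF})\le\mathrm{Reg}^{\mathcal E_n}_{\alpha,f}(\mathcal A)$ and $\mathrm{Reg}^{\mathcal E_n^{+}}_{\alpha,f}(\mathrm{WF})\le\mathrm{Reg}^{\mathcal E_n^{+}}_{\alpha,f}(\mathcal A)$. -/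

import Mathlib

open scoped Matrix Pointwise

namespace OnlineAllocation

/-- An online node: a nonempty neighbourhood of offline nodes and a positive quantity. -/
structure Request (n : ℕ) where
  nbrs : Finset (Fin n)
  qty : ℝ
  nonempty : nbrs.Nonempty
  qty_pos : 0 < qty

/-- The request sequences with `n` offline nodes, `m` online nodes and total quantity `q`. -/
def seqs (n m : ℕ) (q : ℝ) : Set (List (Request n)) :=
  {E | E.length = m ∧ (E.map Request.qty).sum = q}

/-- The feasible allocations of an online node: nonnegative vectors supported on the
neighbourhood that distribute the full quantity. -/
def feasible {n : ℕ} (r : Request n) : Set (Fin n → ℝ) :=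
  {x | (∀ i, 0 ≤ x i) ∧ (∀ i, i ∉ r.nbrs → x i = 0) ∧ ∑ i, x i = r.qty}

/-- The feasible load vectors of a request sequence: the Minkowski sum of the sets of feasible
allocations of its online nodes. -/
def feasibleLoads {n : ℕ} (E : List (Request n)) : Set (Fin n → ℝ) :=
  (E.map feasible).sum

/-- A deterministic online policy: it chooses a feasible allocation from the list of past arrivals
(in order of arrival) and the current one. Its own past decisions are determined by the past
arrivals, so they need not be passed to it. -/
structure Policy (n : ℕ) where
  alloc : List (Request n) → Request n → Fin n → ℝ
  alloc_mem : ∀ past r, alloc past r ∈ feasible r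

/-- The final load vector of a policy on a request sequence. -/
def Policy.load {n : ℕ} (A : Policy n) (E : List (Request n)) : Fin n → ℝ :=
  ∑ t : Fin E.length, A.alloc (E.take t) (E.get t)

/-- The objective maximized by water-filling when the node `r` arrives at loads `l`: the minimal
load among the neighbours of `r` after the allocation `x`. -/
noncomputable def minLoad {n : ℕ} (l : Fin n → ℝ) (r : Request n) (x : Fin n → ℝ) : ℝ :=
  r.nbrs.inf' r.nonempty (fun i => x i + l i)

theorem feasible_nonempty {n : ℕ} (r : Request n) : (feasible r).Nonempty := by
  obtain ⟨k, hk⟩ := r.nonempty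
  refine ⟨Pi.single k r.qty, fun i => ?_, fun i hi => ?_, ?_⟩
  · by_cases h : i = k
    · subst h; simpa using r.qty_pos.le
    · simp [h]
  · have h : i ≠ k := fun h => hi (h ▸ hk)
    simp [h]
  · simp

theorem isCompact_feasible {n : ℕ} (r : Request n) : IsCompact (feasible r) := by
  have hsub : feasible r ⊆ Set.pi Set.univ (fun _ : Fin n => Set.Icc (0 : ℝ) r.qty) := by
    rintro x ⟨h0, -, hs⟩ i -
    refine ⟨h0 i, ?_⟩
    rw [← hs]
    exact Finset.single_le_sum (fun j _ => h0 j) (Finset.mem_univ i)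
  refine (isCompact_univ_pi fun _ => isCompact_Icc).of_isClosed_subset ?_ hsub
  have h1 : IsClosed {x : Fin n → ℝ | ∀ i, 0 ≤ x i} := by
    simp only [Set.ofPred_forall]
    exact isClosed_iInter fun i => isClosed_le continuous_const (continuous_apply i)
  have h2 : IsClosed {x : Fin n → ℝ | ∀ i, i ∉ r.nbrs → x i = 0} := by
    simp only [Set.ofPred_forall]
    exact isClosed_iInter fun i => isClosed_iInter fun _ =>
      isClosed_eq (continuous_apply i) continuous_const
  have h3 : IsClosed {x : Fin n → ℝ | ∑ i, x i = r.qty} :=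
    isClosed_eq (continuous_finsetSum _ fun i _ => continuous_apply i) continuous_const
  exact h1.inter (h2.inter h3)

/-- The convex program of water-filling has exactly one solution. -/
theorem existsUnique_waterFill {n : ℕ} (l : Fin n → ℝ) (r : Request n) :
    ∃! x, x ∈ feasible r ∧ IsMaxOn (minLoad l r) (feasible r) x := by
  have hcont : Continuous (minLoad l r) :=
    Continuous.finset_inf'_apply r.nonempty fun i _ => (continuous_apply i).add continuous_const
  obtain ⟨x, hx, hmax⟩ :=
    (isCompact_feasible r).exists_isMaxOn (feasible_nonempty r) hcont.continuousOn
  -- a maximizer exceeds the least required amount nowhere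
  have key : ∀ y, y ∈ feasible r → IsMaxOn (minLoad l r) (feasible r) y →
      ∀ i ∈ r.nbrs, y i ≤ max 0 (minLoad l r y - l i) := by
    intro y hy hymax i hi
    by_contra! hlt
    obtain ⟨h0, h1⟩ := max_lt_iff.mp hlt
    have hcard : (0 : ℝ) < r.nbrs.card := by exact_mod_cast r.nonempty.card_pos
    set e : ℝ := min (y i) (y i - (minLoad l r y - l i)) / 2 with he
    have hepos : 0 < e := by
      have : 0 < min (y i) (y i - (minLoad l r y - l i)) := lt_min h0 (by linarith)
      positivity
    have he1 : 2 * e ≤ y i := by rw [he]; linarith [min_le_left (y i) (y i - (minLoad l r y - l i))]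
    have he2 : 2 * e ≤ y i - (minLoad l r y - l i) := by
      rw [he]; linarith [min_le_right (y i) (y i - (minLoad l r y - l i))]
    let z : Fin n → ℝ := fun j =>
      y j + (if j ∈ r.nbrs then e / r.nbrs.card else 0) - (if j = i then e else 0)
    have hd : 0 < e / r.nbrs.card := by positivity
    have hz : z ∈ feasible r := by
      refine ⟨fun j => ?_, fun j hj => ?_, ?_⟩
      · have := hy.1 j
        by_cases hji : j = i
        · subst hji; simp only [z, hi, if_true]; linarith
        · simp only [z, hji, if_false]; split_ifs <;> linarith
      · have hji : j ≠ i := fun h => hj (h ▸ hi)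
        simp [z, hj, hji, hy.2.1 j hj]
      · simp only [z, Finset.sum_sub_distrib, Finset.sum_add_distrib, hy.2.2]
        simp only [Finset.sum_ite_mem, Finset.univ_inter, Finset.sum_const, nsmul_eq_mul,
          Finset.sum_ite_eq', Finset.mem_univ, if_true]
        field_simp
        ring
    have hlt' : minLoad l r y < minLoad l r z := by
      refine (Finset.lt_inf'_iff _).2 fun j hj => ?_
      have hle : minLoad l r y ≤ y j + l j := Finset.inf'_le _ hj
      by_cases hji : j = i
      · subst hji; simp only [z, hj, if_true]; linarith
      · simp only [z, hji, hj, if_false, if_true]; linarith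
    exact absurd (hymax hz) (not_le.2 hlt')
  have key' : ∀ y, y ∈ feasible r → IsMaxOn (minLoad l r) (feasible r) y →
      ∀ i ∈ r.nbrs, y i = max 0 (minLoad l r y - l i) := by
    intro y hy hymax i hi
    refine le_antisymm (key y hy hymax i hi) (max_le (hy.1 i) ?_)
    have hle : minLoad l r y ≤ y i + l i := Finset.inf'_le _ hi
    linarith
  refine ⟨x, ⟨hx, hmax⟩, fun y hy => ?_⟩
  have heq : minLoad l r y = minLoad l r x := le_antisymm (hmax hy.1) (hy.2 hx)
  funext i
  by_cases hi : i ∈ r.nbrs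
  · rw [key' y hy.1 hy.2 i hi, key' x hx hmax i hi, heq]
  · rw [hy.1.2.1 i hi, hx.2.1 i hi]

/-- The water-filling allocation of the node `r` arriving at loads `l`: the solution of
`max min_{i ∈ N} (x i + l i)` over the feasible allocations `x`. -/
noncomputable def waterFill {n : ℕ} (l : Fin n → ℝ) (r : Request n) : Fin n → ℝ :=
  (existsUnique_waterFill l r).choose

/-- The loads of water-filling after a list of arrivals. -/
noncomputable def waterFillLoad {n : ℕ} (E : List (Request n)) : Fin n → ℝ :=
  E.foldl (fun l r => l + waterFill l r) 0

/-- The water-filling policy. -/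
noncomputable def WF (n : ℕ) : Policy n where
  alloc past r := waterFill (waterFillLoad past) r
  alloc_mem past r := (existsUnique_waterFill (waterFillLoad past) r).choose_spec.1.1

/-- The entries of `x` in decreasing order. -/
noncomputable def sortDesc {n : ℕ} (x : Fin n → ℝ) : Fin n → ℝ := fun i => x (Tuple.sort x i.rev)

/-- `x` is majorized by `y`: the totals agree, and each sum of the `j` largest entries of `x` is
at most that of `y`. -/
def Majorized {n : ℕ} (x y : Fin n → ℝ) : Prop :=
  ∑ i, x i = ∑ i, y i ∧
    ∀ j : Fin n, ∑ i ∈ Finset.Iic j, sortDesc x i ≤ ∑ i ∈ Finset.Iic j, sortDesc y i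

/-- Schur-concavity of a function on the nonnegative orthant. -/
def SchurConcave {n : ℕ} (f : (Fin n → ℝ) → ℝ) : Prop :=
  ∀ x y : Fin n → ℝ, 0 ≤ x → 0 ≤ y → Majorized x y → f y ≤ f x

/-- The cost of a deterministic policy on a request sequence: `α` times the best objective value
in hindsight, minus the objective value of the policy. -/
noncomputable def cost {n : ℕ} (α : ℝ) (f : (Fin n → ℝ) → ℝ) (A : Policy n)
    (E : List (Request n)) : EReal :=
  (α : EReal) * (⨆ l ∈ feasibleLoads E, (f l : EReal)) - (f (A.load E) : EReal)

/-- The `α`-regret of a policy: its worst-case cost over a class of request sequences. -/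
noncomputable def regret {n : ℕ} (S : Set (List (Request n))) (α : ℝ) (f : (Fin n → ℝ) → ℝ)
    (A : Policy n) : EReal :=
  ⨆ E ∈ S, cost α f A E

/-- The harmonic series matrix. With indices starting from `0`, as here, the entry `1 / (n - j + 1)`
of the column `j` reads `1 / (n - j)`. -/
noncomputable def harmonicMatrix (n : ℕ) : Matrix (Fin n) (Fin n) ℝ :=
  Matrix.of fun i j => if j ≤ i then 1 / ((n : ℝ) - (j : ℝ)) else 0

end OnlineAllocation

open OnlineAllocation

namespace OnlineAllocation

/-! The vector `H l` is the load vector obtained by pouring `l 0`, `l 1`, ... evenly over the nodes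
from position `0`, `1`, ... on. Both bounds compare actual loads with it in the majorization order.
Writing `P k` for the sum of the first `k` entries, `(n - k) * P (k + 1) (H l) = P (k + 1) l + (n -
k - 1) * P k (H l)`. Each bound proves an inequality version of this recursion for its own loads,
and induction on `k` finishes.

Upper bound (`majorized_waterFillLoad`): nodes that end at or below a level `v` under water-filling
cannot receive more in hindsight than water-filling pours below `v`. Hence its loads are majorized
by `H s`, for `s` the sorted version of any feasible load vector.

Lower bound (`exists_majorized_load`): an adversary offers `l k` to the nodes still available, then
withdraws the least loaded one. The minimum is at most the mean, so the loads of any policy majorize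
`H l`; hindsight puts each `l k` on the node withdrawn next and attains a permutation of `l`.

Schur-concavity turns both comparisons into inequalities for `f`. Totals are preserved throughout,
so the bounds meet on every class defined by total quantity. -/

variable {n : ℕ}

/-! ### Partial sums and majorization -/

/-- The sum of the first `k` entries of a vector. -/
def partialSum (k : ℕ) (x : Fin n → ℝ) : ℝ := ∑ i : Fin n, if (i : ℕ) < k then x i else 0

theorem partialSum_zero (x : Fin n → ℝ) : partialSum 0 x = 0 := by simp [partialSum]

theorem partialSum_self (x : Fin n → ℝ) : partialSum n x = ∑ i, x i := by simp [partialSum]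

theorem partialSum_succ (x : Fin n → ℝ) (k : Fin n) :
    partialSum (k + 1) x = partialSum k x + x k := by
  have h : ∀ i : Fin n, (if (i : ℕ) < k + 1 then x i else 0) =
      (if (i : ℕ) < k then x i else 0) + if i = k then x i else 0 := by
    intro i
    rcases lt_trichotomy i k with h | h | h
    · have h' : (i : ℕ) < k := h
      simp [h', h.ne, Nat.lt_succ_of_lt h']
    · simp [h]
    · have h' : (k : ℕ) < i := h
      simp [h.ne', show ¬ (i : ℕ) < k + 1 by omega, show ¬ (i : ℕ) < k by omega]
  simp only [partialSum, h, Finset.sum_add_distrib, Finset.sum_ite_eq', Finset.mem_univ, if_true]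

theorem partialSum_congr {k : ℕ} {x y : Fin n → ℝ} (h : ∀ i : Fin n, (i : ℕ) < k → x i = y i) :
    partialSum k x = partialSum k y :=
  Finset.sum_congr rfl fun i _ => by split_ifs with hi <;> simp [h i, hi]

/-- Rearrangement inequality against the antitone 0-1 weights that select the first `k` positions.
-/
theorem partialSum_le_comp_perm {x : Fin n → ℝ} (hx : Monotone x) (σ : Equiv.Perm (Fin n))
    (k : ℕ) : partialSum k x ≤ partialSum k (x ∘ σ) := by
  have hanti : Antitone fun i : Fin n => if (i : ℕ) < k then (1 : ℝ) else 0 := by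
    intro i j hij
    have hij' : (i : ℕ) ≤ j := hij
    dsimp only
    split_ifs <;> first | omega | norm_num
  have h := (hanti.antivary hx).sum_mul_le_sum_mul_comp_perm (σ := σ)
  simpa [partialSum, ite_mul] using h

theorem sum_Iic_sortDesc (x : Fin n → ℝ) (j : Fin n) :
    ∑ i ∈ Finset.Iic j, sortDesc x i =
      ∑ i, x i - partialSum (j.rev : ℕ) (x ∘ Tuple.sort x) := by
  have h1 : ∑ i, x i = ∑ i, (x ∘ Tuple.sort x) i := (Equiv.sum_comp (Tuple.sort x) x).symm
  have h2 : ∑ i ∈ Finset.Iic j, sortDesc x i =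
      ∑ i : Fin n, if (i : ℕ) < j.rev then 0 else (x ∘ Tuple.sort x) i := by
    rw [← Equiv.sum_comp Fin.revPerm, ← Finset.sum_filter_add_sum_filter_not Finset.univ (· ≤ j),
      Finset.sum_eq_zero (s := Finset.univ.filter fun i => ¬ i ≤ j), add_zero]
    · refine Finset.sum_congr (by ext; simp) fun i hi => ?_
      have hi' : (i : ℕ) ≤ j := (Finset.mem_filter.1 hi).2
      simp only [Fin.revPerm_apply, Fin.val_rev, sortDesc, Function.comp]
      rw [if_neg (by omega)]
    · intro i hi
      have hi' : ¬ (i : ℕ) ≤ j := (Finset.mem_filter.1 hi).2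
      simp only [Fin.revPerm_apply, Fin.val_rev]
      rw [if_pos (by omega)]
  rw [h2, h1, partialSum, ← Finset.sum_sub_distrib]
  exact Finset.sum_congr rfl fun i _ => by split_ifs <;> simp

/-- With equal totals, comparing largest entries amounts to the reverse comparison of smallest
entries. Any `k` entries of `y` sum to at least its `k` smallest, so an arbitrary order `τ` suffices
for `y`; the adversary supplies only such an order. -/
theorem majorized_of_partialSum_le {x y : Fin n → ℝ} (τ : Equiv.Perm (Fin n))
    (hsum : ∑ i, x i = ∑ i, y i)
    (h : ∀ k ≤ n, partialSum k (y ∘ τ) ≤ partialSum k (x ∘ Tuple.sort x)) : Majorized x y := by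
  refine ⟨hsum, fun j => ?_⟩
  rw [sum_Iic_sortDesc, sum_Iic_sortDesc, hsum]
  have h1 := h j.rev j.rev.is_lt.le
  have h2 := partialSum_le_comp_perm (Tuple.monotone_sort y) (τ.trans (Tuple.sort y).symm)
    (j.rev : ℕ)
  have h3 : (y ∘ Tuple.sort y) ∘ (τ.trans (Tuple.sort y).symm) = y ∘ τ := by
    ext i; simp
  rw [h3] at h2
  linarith

theorem comp_sort_eq_of_monotone {x : Fin n → ℝ} (hx : Monotone x) : x ∘ Tuple.sort x = x := by
  rw [Tuple.sort_eq_refl_iff_monotone.2 hx]; rfl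

/-- A vector and its permutation have the same sorted form, so each majorizes the other. -/
theorem SchurConcave.comp_perm {f : (Fin n → ℝ) → ℝ} (hf : SchurConcave f) {x : Fin n → ℝ}
    (hx : 0 ≤ x) (σ : Equiv.Perm (Fin n)) : f (x ∘ σ) = f x := by
  have hx' : 0 ≤ x ∘ σ := fun i => hx (σ i)
  have hs : ∑ i, (x ∘ σ) i = ∑ i, x i := Equiv.sum_comp σ x
  have hsort : (x ∘ σ) ∘ Tuple.sort (x ∘ σ) = x ∘ Tuple.sort x :=
    Tuple.comp_perm_comp_sort_eq_comp_sort
  apply le_antisymm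
  · exact hf _ _ hx hx' (majorized_of_partialSum_le (Tuple.sort (x ∘ σ)) hs.symm
      fun k _ => by rw [hsort])
  · exact hf _ _ hx' hx (majorized_of_partialSum_le (Tuple.sort x) hs
      fun k _ => by rw [hsort])

/-! ### The harmonic matrix -/

/-- The vector of partial sums of `l j / (n - j)`. -/
noncomputable def harmonicSum (l : Fin n → ℝ) (k : ℕ) : ℝ :=
  partialSum k fun j => l j / ((n : ℝ) - (j : ℝ))

theorem harmonicMatrix_mulVec (l : Fin n → ℝ) (i : Fin n) :
    (harmonicMatrix n *ᵥ l) i = harmonicSum l (i + 1) := by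
  simp only [harmonicMatrix, Matrix.mulVec, dotProduct, harmonicSum, partialSum, Matrix.of_apply]
  refine Finset.sum_congr rfl fun j _ => ?_
  by_cases h : j ≤ i
  · have h' : (j : ℕ) < i + 1 := Nat.lt_succ_of_le h
    simp only [h, h', if_true]; ring
  · have h' : ¬ (j : ℕ) < i + 1 := fun h'' => h (Nat.le_of_lt_succ h'')
    simp [h, h']

/-- Conservation of quantity after `k` pours: the first `k` entries are final, and each of the other
`n - k` positions holds `harmonicSum l k`. -/
theorem partialSum_harmonicMatrix_add (l : Fin n → ℝ) {k : ℕ} (hk : k ≤ n) :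
    partialSum k (harmonicMatrix n *ᵥ l) + ((n : ℝ) - k) * harmonicSum l k = partialSum k l := by
  induction k with
  | zero => simp [partialSum_zero, harmonicSum]
  | succ k ih =>
    have ih := ih (by omega)
    have h1 := partialSum_succ (harmonicMatrix n *ᵥ l) ⟨k, hk⟩
    have h2 := partialSum_succ l ⟨k, hk⟩
    have h3 := partialSum_succ (fun j : Fin n => l j / ((n : ℝ) - (j : ℝ))) ⟨k, hk⟩
    have h4 := harmonicMatrix_mulVec l ⟨k, hk⟩
    change harmonicSum l (k + 1) = harmonicSum l k + _ at h3
    simp only at h1 h2 h3 h4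
    have hpos : (n : ℝ) - k ≠ 0 := by
      have : (k : ℝ) < n := by exact_mod_cast hk
      linarith
    have h5 : ((n : ℝ) - k) * (l ⟨k, hk⟩ / ((n : ℝ) - k)) = l ⟨k, hk⟩ := by field_simp
    rw [h1, h2, h4, ← ih, h3]
    push_cast
    linear_combination h5

/-- Eliminating entry `k` from the conservation law leaves a recursion with coefficients `n - k > 0`
and `n - k - 1 ≥ 0`, so inequalities between partial sums propagate through it. -/
theorem mul_partialSum_harmonicMatrix_succ (l : Fin n → ℝ) (k : Fin n) :
    ((n : ℝ) - k) * partialSum (k + 1) (harmonicMatrix n *ᵥ l) =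
      partialSum (k + 1) l + ((n : ℝ) - k - 1) * partialSum k (harmonicMatrix n *ᵥ l) := by
  have h1 := partialSum_succ (harmonicMatrix n *ᵥ l) k
  have h2 := partialSum_harmonicMatrix_add l (show (k : ℕ) + 1 ≤ n from k.is_lt)
  rw [harmonicMatrix_mulVec] at h1
  push_cast at h2
  linear_combination h2 + ((n : ℝ) - k - 1) * h1

theorem sum_harmonicMatrix_mulVec (l : Fin n → ℝ) :
    ∑ i, (harmonicMatrix n *ᵥ l) i = ∑ i, l i := by
  have h := partialSum_harmonicMatrix_add l le_rfl
  simpa [partialSum_self] using h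

theorem div_sub_nonneg {l : Fin n → ℝ} (hl : 0 ≤ l) (j : Fin n) :
    0 ≤ l j / ((n : ℝ) - (j : ℝ)) := by
  have : (j : ℝ) < n := by exact_mod_cast j.is_lt
  exact div_nonneg (hl j) (by linarith)

theorem monotone_harmonicMatrix_mulVec {l : Fin n → ℝ} (hl : 0 ≤ l) :
    Monotone (harmonicMatrix n *ᵥ l) := by
  intro i j hij
  have hij' : (i : ℕ) ≤ j := hij
  rw [harmonicMatrix_mulVec, harmonicMatrix_mulVec, harmonicSum, partialSum, harmonicSum,
    partialSum]
  refine Finset.sum_le_sum fun a _ => ?_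
  have := div_sub_nonneg hl a
  split_ifs <;> first | omega | simp

theorem harmonicMatrix_mulVec_nonneg {l : Fin n → ℝ} (hl : 0 ≤ l) :
    0 ≤ harmonicMatrix n *ᵥ l := by
  intro i
  rw [harmonicMatrix_mulVec, harmonicSum, partialSum]
  refine Finset.sum_nonneg fun a _ => ?_
  have := div_sub_nonneg hl a
  split_ifs <;> simp [this]

/-! ### Loads of policies -/

theorem Policy.load_nil (A : Policy n) : A.load [] = 0 := by simp [Policy.load]

theorem Policy.load_append (A : Policy n) (E : List (Request n)) (r : Request n) :
    A.load (E ++ [r]) = A.load E + A.alloc E r := by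
  have hlen : (E ++ [r]).length = E.length + 1 := by simp
  rw [Policy.load, ← Equiv.sum_comp (finCongr hlen.symm), Fin.sum_univ_castSucc]
  congr 1
  · refine Finset.sum_congr rfl fun t _ => ?_
    have ht := t.is_lt
    simp [List.take_append_of_le_length, ht.le]
  · simp

theorem Policy.load_nonneg (A : Policy n) (E : List (Request n)) : 0 ≤ A.load E := by
  refine Finset.sum_nonneg fun t _ => ?_
  exact (A.alloc_mem _ _).1

theorem Policy.sum_load (A : Policy n) (E : List (Request n)) :
    ∑ i, A.load E i = (E.map Request.qty).sum := by
  induction E using List.reverseRecOn with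
  | nil => simp [Policy.load_nil]
  | append_singleton E r ih =>
    simp [Policy.load_append, Finset.sum_add_distrib, ih, (A.alloc_mem E r).2.2]

theorem load_WF (E : List (Request n)) : (WF n).load E = waterFillLoad E := by
  induction E using List.reverseRecOn with
  | nil => simp [Policy.load_nil, waterFillLoad]
  | append_singleton E r ih =>
    rw [Policy.load_append, ih]
    simp [waterFillLoad, WF, List.foldl_append]

theorem feasibleLoads_nil : feasibleLoads ([] : List (Request n)) = {0} := rfl

theorem feasibleLoads_append (E : List (Request n)) (r : Request n) :
    feasibleLoads (E ++ [r]) = feasibleLoads E + feasible r := by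
  simp [feasibleLoads]

theorem nonneg_of_mem_feasibleLoads {E : List (Request n)} {l : Fin n → ℝ}
    (hl : l ∈ feasibleLoads E) : 0 ≤ l := by
  induction E using List.reverseRecOn generalizing l with
  | nil => rw [feasibleLoads_nil] at hl; exact (Set.mem_singleton_iff.1 hl).ge
  | append_singleton E r ih =>
    rw [feasibleLoads_append] at hl
    obtain ⟨a, ha, x, hx, rfl⟩ := Set.mem_add.1 hl
    exact add_nonneg (ih ha) hx.1

theorem sum_of_mem_feasibleLoads {E : List (Request n)} {l : Fin n → ℝ}
    (hl : l ∈ feasibleLoads E) : ∑ i, l i = (E.map Request.qty).sum := by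
  induction E using List.reverseRecOn generalizing l with
  | nil => rw [feasibleLoads_nil] at hl; simp [Set.mem_singleton_iff.1 hl]
  | append_singleton E r ih =>
    rw [feasibleLoads_append] at hl
    obtain ⟨a, ha, x, hx, rfl⟩ := Set.mem_add.1 hl
    simp [Finset.sum_add_distrib, ih ha, hx.2.2]

/-! ### The upper bound for water-filling -/

theorem waterFill_mem (l : Fin n → ℝ) (r : Request n) : waterFill l r ∈ feasible r :=
  (existsUnique_waterFill l r).choose_spec.1.1

/-- Water-filling only uses neighbours that end up with the minimal load. -/
theorem waterFill_add_le_minLoad (l : Fin n → ℝ) (r : Request n) {i : Fin n}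
    (h0 : 0 < waterFill l r i) : waterFill l r i + l i ≤ minLoad l r (waterFill l r) := by
  have hmax : IsMaxOn (minLoad l r) (feasible r) (waterFill l r) :=
    (existsUnique_waterFill l r).choose_spec.1.2
  have hy := waterFill_mem l r
  set y := waterFill l r
  have hi : i ∈ r.nbrs := by
    by_contra h
    exact h0.ne' (hy.2.1 i h)
  by_contra! hlt
  have hcard : (0 : ℝ) < r.nbrs.card := by exact_mod_cast r.nonempty.card_pos
  obtain ⟨e, he, he1, he2⟩ : ∃ e > 0, e ≤ y i ∧ e ≤ y i + l i - minLoad l r y :=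
    ⟨min (y i) (y i + l i - minLoad l r y), lt_min h0 (by linarith), min_le_left _ _,
      min_le_right _ _⟩
  -- Take `e` from `i` and share it equally among all neighbours: `i` stays above the old minimum
  -- and every neighbour gains a positive share, so the minimum strictly rises.
  let z : Fin n → ℝ := fun j =>
    y j + (if j ∈ r.nbrs then e / r.nbrs.card else 0) - (if j = i then e else 0)
  have hd : 0 < e / r.nbrs.card := by positivity
  have hz : z ∈ feasible r := by
    refine ⟨fun j => ?_, fun j hj => ?_, ?_⟩
    · have := hy.1 j
      by_cases hji : j = i
      · subst hji; simp only [z, hi, if_true]; linarith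
      · simp only [z, hji, if_false]; split_ifs <;> linarith
    · have hji : j ≠ i := fun h => hj (h ▸ hi)
      simp [z, hj, hji, hy.2.1 j hj]
    · simp only [z, Finset.sum_sub_distrib, Finset.sum_add_distrib, hy.2.2]
      simp only [Finset.sum_ite_mem, Finset.univ_inter, Finset.sum_const, nsmul_eq_mul,
        Finset.sum_ite_eq', Finset.mem_univ, if_true]
      field_simp
      ring
  have hzy : minLoad l r z ≤ minLoad l r y := hmax hz
  refine hzy.not_gt ((Finset.lt_inf'_iff _).2 fun j hj => ?_)
  have hle : minLoad l r y ≤ y j + l j := Finset.inf'_le _ hj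
  by_cases hji : j = i
  · subst hji; simp only [z, hj, if_true]; linarith
  · simp only [z, hji, hj, if_false, if_true]; linarith

theorem waterFillLoad_append (E : List (Request n)) (r : Request n) :
    waterFillLoad (E ++ [r]) = waterFillLoad E + waterFill (waterFillLoad E) r := by
  simp [waterFillLoad, List.foldl_append]

/-- The nodes whose final water-filling load is at most `v` receive, under any feasible
allocation, at most the quantity that water-filling pours below the level `v`. -/
theorem sum_le_sum_min_waterFillLoad {E : List (Request n)} {l : Fin n → ℝ}
    (hl : l ∈ feasibleLoads E) {S : Finset (Fin n)} {v : ℝ} (hv : 0 ≤ v)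
    (hS : ∀ i ∈ S, waterFillLoad E i ≤ v) :
    ∑ i ∈ S, l i ≤ ∑ i, min (waterFillLoad E i) v := by
  induction E using List.reverseRecOn generalizing l with
  | nil =>
    rw [feasibleLoads_nil] at hl
    simp [Set.mem_singleton_iff.1 hl, waterFillLoad, hv]
  | append_singleton E r ih =>
    rw [feasibleLoads_append] at hl
    obtain ⟨a, ha, x, hx, rfl⟩ := Set.mem_add.1 hl
    rw [waterFillLoad_append] at hS ⊢
    set w := waterFillLoad E
    have hy := waterFill_mem w r
    have hlevel := fun i => waterFill_add_le_minLoad w r (i := i)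
    set y := waterFill w r
    have hIH := ih ha fun i hi => by
      have h1 := hS i hi
      have h2 := hy.1 i
      simp only [Pi.add_apply] at h1
      linarith
    suffices h : ∑ i ∈ S, x i + ∑ i, min (w i) v ≤ ∑ i, min ((w + y) i) v by
      simp only [Pi.add_apply, Finset.sum_add_distrib] at h ⊢
      linarith
    -- If `r` has a neighbour in `S`, water-filling ends this step at level at most `v`, so all of
    -- `r.qty` lands below `v`. Otherwise `x` gives `S` nothing.
    by_cases hdisj : ∃ i ∈ S, i ∈ r.nbrs
    · obtain ⟨k, hkS, hkN⟩ := hdisj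
      have hmin : minLoad w r y ≤ v := by
        have h1 : minLoad w r y ≤ y k + w k := Finset.inf'_le _ hkN
        have h2 := hS k hkS
        simp only [Pi.add_apply] at h2
        linarith
      have h1 : ∑ i ∈ S, x i ≤ ∑ i, y i := by
        rw [hy.2.2, ← hx.2.2]
        exact Finset.sum_le_sum_of_subset_of_nonneg (Finset.subset_univ _) fun i _ _ => hx.1 i
      have h2 : ∑ i, y i + ∑ i, min (w i) v ≤ ∑ i, min ((w + y) i) v := by
        rw [← Finset.sum_add_distrib]
        refine Finset.sum_le_sum fun i _ => ?_
        simp only [Pi.add_apply]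
        rcases (hy.1 i).lt_or_eq with h | h
        · have h3 := hlevel i h
          rw [min_eq_left (by linarith), min_eq_left (by linarith)]
          linarith
        · rw [← h]; simp
      linarith
    · push Not at hdisj
      rw [Finset.sum_eq_zero fun i hi => hx.2.1 i (hdisj i hi), zero_add]
      refine Finset.sum_le_sum fun i _ => min_le_min_right _ ?_
      simpa using hy.1 i

theorem waterFillLoad_nonneg (E : List (Request n)) : 0 ≤ waterFillLoad E :=
  load_WF E ▸ (WF n).load_nonneg E

theorem sum_min_of_monotone {u : Fin n → ℝ} (hu : Monotone u) (k : Fin n) :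
    ∑ i, min (u i) (u k) = partialSum (k + 1) u + ((n : ℝ) - k - 1) * u k := by
  have h : ∀ i : Fin n, min (u i) (u k) =
      (if (i : ℕ) < k + 1 then u i else 0) + (u k - if (i : ℕ) < k + 1 then u k else 0) := by
    intro i
    by_cases hik : i ≤ k
    · have : (i : ℕ) < k + 1 := Nat.lt_succ_of_le hik
      simp [this, hu hik]
    · have : ¬ (i : ℕ) < k + 1 := fun h => hik (Nat.le_of_lt_succ h)
      simp [this, hu (not_le.1 hik).le]
  have hcard : ∑ i : Fin n, (if (i : ℕ) < k + 1 then u k else 0) = ((k : ℝ) + 1) * u k := by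
    have h1 : ∀ i : Fin n, (i : ℕ) < k + 1 ↔ i ∈ Finset.Iic k := by
      intro i; rw [Finset.mem_Iic, Fin.le_def]; omega
    simp only [h1, Finset.sum_ite_mem, Finset.univ_inter, Finset.sum_const, Fin.card_Iic,
      nsmul_eq_mul]
    push_cast; ring
  simp only [h, Finset.sum_add_distrib, Finset.sum_sub_distrib, hcard, Finset.sum_const,
    Finset.card_univ, Fintype.card_fin, nsmul_eq_mul, partialSum]
  ring

/-- The loads of water-filling are majorized by the harmonic matrix times any sorted feasible
load vector. -/
theorem majorized_waterFillLoad {E : List (Request n)} {l : Fin n → ℝ}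
    (hl : l ∈ feasibleLoads E) :
    Majorized (waterFillLoad E) (harmonicMatrix n *ᵥ (l ∘ Tuple.sort l)) := by
  set w := waterFillLoad E with hw
  set s := l ∘ Tuple.sort l
  have hmono : Monotone (w ∘ Tuple.sort w) := Tuple.monotone_sort w
  set u := w ∘ Tuple.sort w
  have hsum : ∑ i, w i = ∑ i, (harmonicMatrix n *ᵥ s) i := by
    rw [sum_harmonicMatrix_mulVec, hw, ← load_WF, Policy.sum_load, ← sum_of_mem_feasibleLoads hl]
    exact (Equiv.sum_comp (Tuple.sort l) l).symm
  -- Apply the level bound to the `k + 1` nodes with the smallest water-filling loads and `v = u k`;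
  -- since `s` is sorted, `l` has at least `partialSum (k + 1) s` on them.
  have key : ∀ k : Fin n, partialSum (k + 1) s ≤
      partialSum (k + 1) u + ((n : ℝ) - k - 1) * u k := by
    intro k
    have h1 := sum_le_sum_min_waterFillLoad hl (S := (Finset.Iic k).map (Tuple.sort w).toEmbedding)
      (v := u k) (waterFillLoad_nonneg E _) (by
        intro i hi
        obtain ⟨j, hj, rfl⟩ := Finset.mem_map.1 hi
        exact hmono (Finset.mem_Iic.1 hj))
    have h2 : ∑ i, min (w i) (u k) = ∑ i, min (u i) (u k) :=
      (Equiv.sum_comp (Tuple.sort w) fun i => min (w i) (u k)).symm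
    have h3 : ∑ i ∈ (Finset.Iic k).map (Tuple.sort w).toEmbedding, l i =
        partialSum (k + 1) (l ∘ Tuple.sort w) := by
      have h4 : ∀ i : Fin n, (i : ℕ) < k + 1 ↔ i ∈ Finset.Iic k := by
        intro i; rw [Finset.mem_Iic, Fin.le_def]; omega
      simp only [partialSum, h4, Finset.sum_ite_mem, Finset.univ_inter, Finset.sum_map]
      rfl
    have h5 := partialSum_le_comp_perm (Tuple.monotone_sort l)
      ((Tuple.sort w).trans (Tuple.sort l).symm) (k + 1)
    have h6 : (l ∘ Tuple.sort l) ∘ ((Tuple.sort w).trans (Tuple.sort l).symm) =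
        l ∘ Tuple.sort w := by ext i; simp
    rw [h6] at h5
    rw [h3, h2, sum_min_of_monotone hmono] at h1
    exact h5.trans h1
  refine majorized_of_partialSum_le (Equiv.refl _) hsum fun k hk => ?_
  change partialSum k (harmonicMatrix n *ᵥ s) ≤ partialSum k u
  induction k with
  | zero => simp [partialSum_zero]
  | succ k ih =>
    have ih := ih (by omega)
    have h1 := key ⟨k, hk⟩
    have h2 := partialSum_succ u ⟨k, hk⟩
    have h3 := mul_partialSum_harmonicMatrix_succ s ⟨k, hk⟩
    simp only at h1 h2 h3
    have hpos : (1 : ℝ) ≤ (n : ℝ) - k := by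
      have : ((k + 1 : ℕ) : ℝ) ≤ n := by exact_mod_cast hk
      push_cast at this; linarith
    have h4 : ((n : ℝ) - k - 1) * partialSum k (harmonicMatrix n *ᵥ s) ≤
        ((n : ℝ) - k - 1) * partialSum k u := mul_le_mul_of_nonneg_left ih (by linarith)
    -- Eliminating the entry puts `key` in the form of the recursion for `H s`.
    have h5 : u ⟨k, hk⟩ = partialSum (k + 1) u - partialSum k u := by linarith
    rw [h5] at h1
    refine le_of_mul_le_mul_left ?_ (show (0 : ℝ) < (n : ℝ) - k by linarith)
    linarith

/-! ### The lower bound for all policies -/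

/-- An adversary that repeatedly withdraws a least loaded offline node. -/
theorem exists_adversary (A : Policy n) {l : Fin n → ℝ} (hl : 0 ≤ l) {k : ℕ} (hk : k ≤ n) :
    ∃ (E : List (Request n)) (τ : Equiv.Perm (Fin n)),
      ((fun i : Fin n => if (i : ℕ) < k then l i else 0) ∘ τ.symm) ∈ feasibleLoads E ∧
      ∀ j ≤ k, partialSum j (A.load E ∘ τ) ≤ partialSum j (harmonicMatrix n *ᵥ l) := by
  induction k with
  | zero =>
    refine ⟨[], Equiv.refl _, ?_, fun j hj => ?_⟩
    · rw [feasibleLoads_nil, Set.mem_singleton_iff]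
      ext i; simp
    · rw [Nat.le_zero.1 hj, partialSum_zero, partialSum_zero]
  | succ k ih =>
    -- The order `τ` lists the `k` withdrawn nodes first, in order of withdrawal.
    obtain ⟨E, τ, hmem, hle⟩ := ih (by omega)
    let κ : Fin n := ⟨k, hk⟩
    -- the loads after the next arrival, which is void if its quantity vanishes
    obtain ⟨E', hE', hfix⟩ : ∃ E' : List (Request n),
        (∀ i : Fin n, k ≤ (i : ℕ) →
          ((fun i : Fin n => if (i : ℕ) < k then l i else 0) ∘ τ.symm) + Pi.single (τ i) (l κ) ∈
            feasibleLoads E') ∧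
        ∀ i : Fin n, (i : ℕ) < k → A.load E' (τ i) = A.load E (τ i) := by
      rcases (hl κ).lt_or_eq with hpos | hzero
      · let r : Request n :=
          { nbrs := (Finset.Ici κ).map τ.toEmbedding
            qty := l κ
            nonempty := ⟨τ κ, by simp⟩
            qty_pos := hpos }
        refine ⟨E ++ [r], fun i hi => ?_, fun i hi => ?_⟩
        · rw [feasibleLoads_append]
          refine Set.add_mem_add hmem ⟨fun j => ?_, fun j hj => ?_, by simp [r]⟩
          · by_cases hji : j = τ i
            · subst hji; simpa using hpos.le
            · simp [hji]
          · have hji : j ≠ τ i := by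
              rintro rfl
              exact hj (Finset.mem_map_of_mem _ (Finset.mem_Ici.2 hi))
            simp [hji]
        · rw [Policy.load_append, Pi.add_apply, (A.alloc_mem E r).2.1, add_zero]
          intro h
          obtain ⟨j, hj, hji⟩ := Finset.mem_map.1 h
          have hji' : j = i := τ.injective hji
          rw [hji', Finset.mem_Ici, Fin.le_def] at hj
          exact absurd hj (not_le.2 hi)
      · refine ⟨E, fun i _ => ?_, fun i _ => rfl⟩
        rw [← hzero]
        simpa using hmem
    obtain ⟨p, hp, hpmin⟩ := Finset.exists_min_image (Finset.Ici κ) (fun i => A.load E' (τ i))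
      ⟨κ, by simp⟩
    have hκp : κ ≤ p := Finset.mem_Ici.1 hp
    have hkp : k ≤ (p : ℕ) := hκp
    -- The least loaded remaining node moves to position `k`; the positions of withdrawn nodes stay
    -- fixed.
    let τ' : Equiv.Perm (Fin n) := (Equiv.swap κ p).trans τ
    have hτ'lt : ∀ i : Fin n, (i : ℕ) < k → τ' i = τ i := by
      intro i hi
      have h1 : i ≠ κ := by rintro rfl; exact lt_irrefl _ hi
      have h2 : i ≠ p := by rintro rfl; omega
      simp [τ', Equiv.swap_apply_of_ne_of_ne h1 h2]
    have hτ'κ : τ' κ = τ p := by simp [τ']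
    have hsumE' : ∑ i, A.load E' i = partialSum (k + 1) l := by
      rw [Policy.sum_load, ← sum_of_mem_feasibleLoads (hE' κ le_rfl), partialSum_succ l κ]
      simp only [Pi.add_apply, Finset.sum_add_distrib, Finset.sum_pi_single', Finset.mem_univ,
        if_true]
      congr 1
      exact Equiv.sum_comp τ.symm fun i : Fin n => if (i : ℕ) < k then l i else 0
    have hprefix : ∀ j ≤ k, partialSum j (A.load E' ∘ τ') = partialSum j (A.load E ∘ τ) :=
      fun j hj => partialSum_congr fun i hi => by
        simp only [Function.comp, hτ'lt i (by omega), hfix i (by omega)]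
    refine ⟨E', τ', ?_, fun j hj => ?_⟩
    -- The node `p` is known only after the policy has reacted, which is why `hE'` covers every
    -- remaining position.
    · convert hE' p hkp using 1
      ext a
      obtain ⟨i, rfl⟩ := τ'.surjective a
      simp only [Function.comp, Pi.add_apply, Equiv.symm_apply_apply, ← hτ'κ, Pi.single_apply,
        τ'.injective.eq_iff]
      have hsymm : τ.symm (τ' i) = Equiv.swap κ p i := by simp [τ']
      rw [hsymm]
      by_cases hik : i = κ
      · subst hik
        simp [κ, show ¬ (p : ℕ) < k by omega]
      · have hik' : (i : ℕ) ≠ k := fun h => hik (Fin.ext h)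
        by_cases hip : i = p
        · subst hip
          simp [κ, hik, show ¬ (i : ℕ) < k + 1 by omega]
        · rw [Equiv.swap_apply_of_ne_of_ne hik hip]
          have : (i : ℕ) < k + 1 ↔ (i : ℕ) < k := by omega
          simp [hik, this]
    · rcases Nat.lt_succ_iff_lt_or_eq.1 (Nat.lt_succ_of_le hj) with hj' | rfl
      · rw [hprefix j (by omega)]
        exact hle j (by omega)
      · have h1 := partialSum_succ (A.load E' ∘ τ') κ
        have h2 := mul_partialSum_harmonicMatrix_succ l κ
        have h3 := hle k le_rfl
        rw [← hprefix k le_rfl] at h3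
        -- Each of the `n - k` remaining nodes carries at least the load of the one withdrawn, and
        -- the total is `partialSum (k + 1) l`.
        have hmean : partialSum k (A.load E' ∘ τ') +
            ((n : ℝ) - k) * (A.load E' ∘ τ') κ ≤ partialSum (k + 1) l := by
          have hcard : ∑ i : Fin n, (if (i : ℕ) < k then 0 else (A.load E' ∘ τ') κ) =
              ((n : ℝ) - k) * (A.load E' ∘ τ') κ := by
            have h4 : ∀ i : Fin n, (if (i : ℕ) < k then 0 else (A.load E' ∘ τ') κ) =
                if i ∈ Finset.Ici κ then (A.load E' ∘ τ') κ else 0 := by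
              intro i
              by_cases h : (i : ℕ) < k
              · have : ¬ κ ≤ i := not_le.2 h
                simp [h, this]
              · have : κ ≤ i := not_lt.1 h
                simp [h, this]
            simp only [h4, Finset.sum_ite_mem, Finset.univ_inter, Finset.sum_const, Fin.card_Ici,
              nsmul_eq_mul]
            rw [Nat.cast_sub κ.is_lt.le]
          rw [← hsumE', ← hcard, partialSum, ← Finset.sum_add_distrib, ← Equiv.sum_comp τ' (A.load E')]
          refine Finset.sum_le_sum fun i _ => ?_
          by_cases h : (i : ℕ) < k
          · simp [h]
          · simp only [h, if_false, zero_add, Function.comp, hτ'κ]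
            have hmem' : Equiv.swap κ p i ∈ Finset.Ici κ := by
              rw [Finset.mem_Ici]
              have hi : κ ≤ i := not_lt.1 h
              rw [Equiv.swap_apply_def]
              split_ifs
              · exact hκp
              · exact le_rfl
              · exact hi
            exact hpmin _ hmem'
        have hκ : (κ : ℕ) = k := rfl
        rw [hκ] at h1 h2
        have hpos : (1 : ℝ) ≤ (n : ℝ) - k := by
          have : ((k + 1 : ℕ) : ℝ) ≤ n := by exact_mod_cast hk
          push_cast at this; linarith
        have h4 : ((n : ℝ) - k - 1) * partialSum k (A.load E' ∘ τ') ≤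
            ((n : ℝ) - k - 1) * partialSum k (harmonicMatrix n *ᵥ l) :=
          mul_le_mul_of_nonneg_left h3 (by linarith)
        have h5 : (A.load E' ∘ τ') κ =
            partialSum (k + 1) (A.load E' ∘ τ') - partialSum k (A.load E' ∘ τ') := by linarith
        rw [h5] at hmean
        refine le_of_mul_le_mul_left ?_ (show (0 : ℝ) < (n : ℝ) - k by linarith)
        linarith

/-- The adversary runs until all `n` nodes are withdrawn. As `H l` is already increasing, its first
entries are its smallest, as the majorization criterion needs. -/
theorem exists_majorized_load (A : Policy n) {l : Fin n → ℝ} (hl : 0 ≤ l) :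
    ∃ (E : List (Request n)) (σ : Equiv.Perm (Fin n)),
      l ∘ σ ∈ feasibleLoads E ∧ Majorized (harmonicMatrix n *ᵥ l) (A.load E) := by
  obtain ⟨E, τ, hmem, hle⟩ := exists_adversary A hl le_rfl
  have hmem' : l ∘ τ.symm ∈ feasibleLoads E := by simpa [Function.comp_def] using hmem
  refine ⟨E, τ.symm, hmem', majorized_of_partialSum_le τ ?_ fun k hk => ?_⟩
  · rw [sum_harmonicMatrix_mulVec, Policy.sum_load, ← sum_of_mem_feasibleLoads hmem']
    exact (Equiv.sum_comp τ.symm l).symm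
  · rw [comp_sort_eq_of_monotone (monotone_harmonicMatrix_mulVec hl)]
    exact hle k hk

/-! ### Regrets -/

/-- The hindsight supremum may be infinite, but `α` is positive and finite and `f (A.load E)` is
real, so both can be moved across the inequality and the bound checked for each `l`. -/
theorem cost_le {α : ℝ} (hα : 0 < α) {f : (Fin n → ℝ) → ℝ} {A : Policy n}
    {E : List (Request n)} {R : EReal}
    (h : ∀ l ∈ feasibleLoads E, ((α * f l - f (A.load E) : ℝ) : EReal) ≤ R) :
    cost α f A E ≤ R := by
  have hα' : (0 : EReal) < α := by exact_mod_cast hα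
  rw [cost, EReal.sub_le_iff_le_add (.inl (EReal.coe_ne_bot _)) (.inl (EReal.coe_ne_top _)),
    mul_comm, ← EReal.le_div_iff_mul_le hα' (EReal.coe_ne_top _)]
  refine iSup₂_le fun l hl => ?_
  rw [EReal.le_div_iff_mul_le hα' (EReal.coe_ne_top _), mul_comm,
    ← EReal.sub_le_iff_le_add (.inl (EReal.coe_ne_bot _)) (.inl (EReal.coe_ne_top _))]
  exact_mod_cast h l hl

theorem le_cost {α : ℝ} (hα : 0 < α) (f : (Fin n → ℝ) → ℝ) (A : Policy n)
    {E : List (Request n)} {l : Fin n → ℝ} (hl : l ∈ feasibleLoads E) :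
    ((α * f l - f (A.load E) : ℝ) : EReal) ≤ cost α f A E := by
  have hα' : (0 : EReal) ≤ α := by exact_mod_cast hα.le
  have h : (f l : EReal) ≤ ⨆ l ∈ feasibleLoads E, (f l : EReal) :=
    le_iSup₂ (f := fun l (_ : l ∈ feasibleLoads E) => (f l : EReal)) l hl
  rw [EReal.coe_sub, EReal.coe_mul]
  exact EReal.sub_le_sub (mul_le_mul_of_nonneg_left h hα') le_rfl

theorem mem_iUnion_seqs {Q : Set ℝ} {E : List (Request n)} :
    E ∈ (⋃ (m : ℕ) (q ∈ Q), seqs n m q) ↔ (E.map Request.qty).sum ∈ Q := by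
  simp [seqs]

/-- The regret of water-filling is at most the supremum of the harmonic gap, over any class of
request sequences given by their total quantities. -/
theorem regret_WF_le {α : ℝ} (hα : 0 < α) {f : (Fin n → ℝ) → ℝ} (hf : SchurConcave f)
    (Q : Set ℝ) :
    regret (⋃ (m : ℕ) (q ∈ Q), seqs n m q) α f (WF n) ≤
      ⨆ l ∈ {l : Fin n → ℝ | 0 ≤ l ∧ Monotone l ∧ ∑ i, l i ∈ Q},
        ((α * f l - f (harmonicMatrix n *ᵥ l) : ℝ) : EReal) := by
  refine iSup₂_le fun E hE => cost_le hα fun l hl => ?_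
  have hl0 := nonneg_of_mem_feasibleLoads hl
  have hs0 : 0 ≤ l ∘ Tuple.sort l := fun i => hl0 (Tuple.sort l i)
  have hmaj := hf _ _ (waterFillLoad_nonneg E) (harmonicMatrix_mulVec_nonneg hs0)
    (majorized_waterFillLoad hl)
  have hmem : l ∘ Tuple.sort l ∈ {l : Fin n → ℝ | 0 ≤ l ∧ Monotone l ∧ ∑ i, l i ∈ Q} := by
    refine ⟨hs0, Tuple.monotone_sort l, ?_⟩
    have h : ∑ i, (l ∘ Tuple.sort l) i = ∑ i, l i := Equiv.sum_comp (Tuple.sort l) l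
    rw [h, sum_of_mem_feasibleLoads hl]
    exact mem_iUnion_seqs.1 hE
  refine le_trans ?_ (le_iSup₂ (f := fun l (_ : l ∈ {l : Fin n → ℝ | 0 ≤ l ∧ Monotone l ∧
    ∑ i, l i ∈ Q}) => ((α * f l - f (harmonicMatrix n *ᵥ l) : ℝ) : EReal)) _ hmem)
  rw [hf.comp_perm hl0, load_WF, EReal.coe_le_coe_iff]
  linarith

/-- Every deterministic policy has at least the supremum of the harmonic gap as its regret. -/
theorem le_regret {α : ℝ} (hα : 0 < α) {f : (Fin n → ℝ) → ℝ} (hf : SchurConcave f)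
    (Q : Set ℝ) (A : Policy n) :
    ⨆ l ∈ {l : Fin n → ℝ | 0 ≤ l ∧ Monotone l ∧ ∑ i, l i ∈ Q},
        ((α * f l - f (harmonicMatrix n *ᵥ l) : ℝ) : EReal) ≤
      regret (⋃ (m : ℕ) (q ∈ Q), seqs n m q) α f A := by
  refine iSup₂_le fun l hl => ?_
  obtain ⟨hl0, -, hlQ⟩ := hl
  obtain ⟨E, σ, hmem, hmaj⟩ := exists_majorized_load A hl0
  have hle := hf _ _ (harmonicMatrix_mulVec_nonneg hl0) (A.load_nonneg E) hmaj
  have hE : E ∈ (⋃ (m : ℕ) (q ∈ Q), seqs n m q) := by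
    rw [mem_iUnion_seqs, ← sum_of_mem_feasibleLoads hmem]
    have h : ∑ i, (l ∘ σ) i = ∑ i, l i := Equiv.sum_comp σ l
    rwa [h]
  refine le_trans ?_ ((le_cost hα f A hmem).trans (le_iSup₂ (f := fun E
    (_ : E ∈ (⋃ (m : ℕ) (q ∈ Q), seqs n m q)) => cost α f A E) E hE))
  rw [hf.comp_perm hl0, EReal.coe_le_coe_iff]
  linarith

theorem sum_pos_iff_ne_zero {l : Fin n → ℝ} (hl : 0 ≤ l) : 0 < ∑ i, l i ↔ l ≠ 0 := by
  rw [(Finset.sum_nonneg fun i _ => hl i).lt_iff_ne', Ne, Finset.sum_eq_zero_iff_of_nonneg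
    fun i _ => hl i]
  simp [funext_iff]

end OnlineAllocation

open OnlineAllocation
theorem mainTheorem6 (n : ℕ) (α : ℝ) (hα : 0 < α) (f : (Fin n → ℝ) → ℝ)
    (hf_nonneg : ∀ x, 0 ≤ x → 0 ≤ f x) (hf : SchurConcave f) :
    -- all numbers of online nodes and all total quantities `q ≥ 0`
    -- (`q = 0` is the empty sequence)
    (regret (⋃ (m : ℕ) (q ∈ Set.Ici (0 : ℝ)), seqs n m q) α f (WF n) =
      ⨆ l ∈ {l : Fin n → ℝ | 0 ≤ l ∧ Monotone l},
        ((α * f l - f (harmonicMatrix n *ᵥ l) : ℝ) : EReal)) ∧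
    -- all numbers of online nodes and all total quantities `q > 0`
    (regret (⋃ (m : ℕ) (q ∈ Set.Ioi (0 : ℝ)), seqs n m q) α f (WF n) =
      ⨆ l ∈ {l : Fin n → ℝ | 0 ≤ l ∧ Monotone l ∧ l ≠ 0},
        ((α * f l - f (harmonicMatrix n *ᵥ l) : ℝ) : EReal)) ∧
    -- these regrets are minimal among all deterministic policies
    (∀ A : Policy n,
      regret (⋃ (m : ℕ) (q ∈ Set.Ici (0 : ℝ)), seqs n m q) α f (WF n) ≤
        regret (⋃ (m : ℕ) (q ∈ Set.Ici (0 : ℝ)), seqs n m q) α f A ∧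
      regret (⋃ (m : ℕ) (q ∈ Set.Ioi (0 : ℝ)), seqs n m q) α f (WF n) ≤
        regret (⋃ (m : ℕ) (q ∈ Set.Ioi (0 : ℝ)), seqs n m q) α f A) := by
  -- Both index sets are recast as constraints on the total, so that one pair of bounds, for a
  -- general `Q`, serves both classes.
  have hIci : {l : Fin n → ℝ | 0 ≤ l ∧ Monotone l} =
      {l | 0 ≤ l ∧ Monotone l ∧ ∑ i, l i ∈ Set.Ici (0 : ℝ)} := by
    ext l
    exact ⟨fun h => ⟨h.1, h.2, Finset.sum_nonneg fun i _ => h.1 i⟩, fun h => ⟨h.1, h.2.1⟩⟩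
  have hIoi : {l : Fin n → ℝ | 0 ≤ l ∧ Monotone l ∧ l ≠ 0} =
      {l | 0 ≤ l ∧ Monotone l ∧ ∑ i, l i ∈ Set.Ioi (0 : ℝ)} := by
    ext l
    exact and_congr_right fun h => and_congr_right fun _ => (sum_pos_iff_ne_zero h).symm
  rw [hIci, hIoi]
  exact ⟨le_antisymm (regret_WF_le hα hf _) (le_regret hα hf _ _),
    le_antisymm (regret_WF_le hα hf _) (le_regret hα hf _ _),
    fun A => ⟨(regret_WF_le hα hf _).trans (le_regret hα hf _ A),
      (regret_WF_le hα hf _).trans (le_regret hα hf _ A)⟩⟩
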